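/- Graphs are finite, simple and undirected. For a graph $H$ let $d(H) = 2|E(H)|/|V(H)|$ be its average degree. For an integer $t \ge 1$, the blowup $H \otimes J_t$ is the graph with vertices $v^{(i)}$ for $v \in V(H)$, $i \in \{1,\dots,t\}$, and edge set $$\{u^{(i)}v^{(j)} : uv \in E(H),\ 1 \le i,j \le t\} \cup \{u^{(i)}u^{(j)} : u \in V(H),\ 1 \le i \ne j \le t\}.$$ A set $X$ of vertices of a graph $G$ is called matching-linked in $G$ if, for every set $M$ of pairwise disjoint two-element subsets of $X$ (which need neither be edges of $G$ nor cover $X$), there are pairwise vertex-disjoint paths $P_{uv}$ in $G$, one for each $\{u,v\} \in M$, such that $P_{uv}$ has endpoints $u$ and $v$. The linkage capacity $\gamma(H)$ is the supremum of all real $c > 0$ such that, for all sufficiently large $t$, the graph $H \otimes J_t$ contains a matching-linked set $X$ with $|X| = \lfloor ct \rfloor$. **Lemma 5.3.** Every graph $H$ satisfies $\gamma(H) \ge d(H)/48$. -/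

import Mathlib

/-- The average degree `2 |E(H)| / |V(H)|` of a finite graph. -/
noncomputable def averageDegree {V : Type*} (H : SimpleGraph V) : ℝ :=
  2 * (H.edgeSet.ncard : ℝ) / (Nat.card V : ℝ)

/-- The blowup of `H` of order `t`: every vertex `v` is replaced by `t` clones `(v, i)`. Clones of
adjacent vertices are adjacent, and distinct clones of the same vertex are adjacent. -/
def blowup {V : Type*} (H : SimpleGraph V) (t : ℕ) : SimpleGraph (V × Fin t) where
  Adj x y := H.Adj x.1 y.1 ∨ (x.1 = y.1 ∧ x.2 ≠ y.2)
  symm := ⟨fun _ _ h => h.elim (fun h => Or.inl h.symm) (fun h => Or.inr ⟨h.1.symm, h.2.symm⟩)⟩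
  loopless := ⟨fun x h => h.elim (fun h => H.loopless.irrefl x.1 h) (fun h => h.2 rfl)⟩

/-- An `M`-linkage in `H`: for each edge `e` of `M` a path in `H` joining the two endpoints of `e`.
`M` is a graph on vertices of `H` whose edges need not be edges of `H`. As a path from `u` to `v`
also counts as one from `v` to `u`, the linkage may orient each edge of `M` as it likes. -/
structure Linkage {V : Type*} (H : SimpleGraph V) (M : (⊤ : SimpleGraph V).Subgraph) where
  /-- the first endpoint of an edge -/
  src : M.edgeSet → V
  /-- the second endpoint of an edge -/
  tgt : M.edgeSet → V
  endpoints : ∀ e : M.edgeSet, s(src e, tgt e) = (e : Sym2 V)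
  /-- the path that realizes an edge -/
  path : ∀ e : M.edgeSet, H.Path (src e) (tgt e)

/-- A linkage is `r`-congested if every vertex lies on at most `r` of its paths. -/
def Linkage.IsCongested {V : Type*} {H : SimpleGraph V} {M : (⊤ : SimpleGraph V).Subgraph}
    (Q : Linkage H M) (r : ℕ) : Prop :=
  ∀ w : V, {e : M.edgeSet | w ∈ (Q.path e : H.Walk (Q.src e) (Q.tgt e)).support}.encard ≤ r

/-- A linkage is uncongested if it is `1`-congested, that is, its paths are vertex-disjoint. -/
def Linkage.IsUncongested {V : Type*} {H : SimpleGraph V} {M : (⊤ : SimpleGraph V).Subgraph}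
    (Q : Linkage H M) : Prop :=
  Q.IsCongested 1

/-- `X` is matching-linked in `H` if `H` contains an uncongested `M`-linkage for every matching `M`
on `X`, that is, every set `M` of pairwise disjoint pairs of distinct vertices all of whose
endpoints lie in `X` (neither do these pairs have to be edges of `H`, nor need they cover `X`). -/
def IsMatchingLinked {V : Type*} (H : SimpleGraph V) (X : Set V) : Prop :=
  ∀ M : (⊤ : SimpleGraph V).Subgraph, M.IsMatching → M.verts ⊆ X →
    ∃ Q : Linkage H M, Q.IsUncongested

/-- The set of all `c > 0` such that, for all large enough `t`, the blowup of order `t` contains a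
matching-linked set of size `⌊c t⌋`. -/
def linkageRates {V : Type*} (H : SimpleGraph V) : Set ℝ :=
  {c : ℝ | 0 < c ∧ ∀ᶠ t : ℕ in Filter.atTop, ∃ X : Finset (V × Fin t),
    X.card = ⌊c * (t : ℝ)⌋₊ ∧ IsMatchingLinked (blowup H t) (X : Set (V × Fin t))}

/-- The linkage capacity of `H`. -/
noncomputable def linkageCapacity {V : Type*} (H : SimpleGraph V) : ℝ :=
  sSup (linkageRates H)

/-- The supremum that defines the linkage capacity is taken over a bounded set. -/
theorem bddAbove_linkageRates {V : Type*} [Finite V] (H : SimpleGraph V) :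
    BddAbove (linkageRates H) := by
  refine ⟨(Nat.card V : ℝ) + 1, ?_⟩
  rintro c ⟨-, hc⟩
  obtain ⟨t, ⟨X, hX, -⟩, ht⟩ := (hc.and (Filter.eventually_ge_atTop 1)).exists
  have := Fintype.ofFinite V
  have h1 : X.card ≤ Nat.card V * t := by
    simpa [Nat.card_eq_fintype_card] using X.card_le_univ
  have h2 : c * t < (⌊c * (t : ℝ)⌋₊ : ℝ) + 1 := Nat.lt_floor_add_one _
  have h3 : ((⌊c * (t : ℝ)⌋₊ : ℕ) : ℝ) ≤ (Nat.card V : ℝ) * t := by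
    rw [← hX]; exact_mod_cast h1
  have ht' : (1 : ℝ) ≤ t := by exact_mod_cast ht
  by_contra h
  push Not at h
  nlinarith

/-- The supremum that defines the linkage capacity is taken over a nonempty set. -/
theorem one_mem_linkageRates {V : Type*} [Nonempty V] (H : SimpleGraph V) :
    (1 : ℝ) ∈ linkageRates H := by
  obtain ⟨v⟩ := ‹Nonempty V›
  refine ⟨one_pos, Filter.Eventually.of_forall fun t => ?_⟩
  refine ⟨Finset.univ.map ⟨fun i : Fin t => (v, i), fun i j h => (Prod.ext_iff.1 h).2⟩,
    by simp, ?_⟩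
  intro M hM hX
  have hout : ∀ e : M.edgeSet, s((e : Sym2 (V × Fin t)).out.1, (e : Sym2 (V × Fin t)).out.2) =
      (e : Sym2 (V × Fin t)) := fun e => Quot.out_eq _
  have hadjM : ∀ e : M.edgeSet, M.Adj (e : Sym2 (V × Fin t)).out.1
      (e : Sym2 (V × Fin t)).out.2 := fun e => by
    rw [← SimpleGraph.Subgraph.mem_edgeSet, hout]; exact e.2
  have hfst : ∀ x ∈ M.verts, x.1 = v := fun x hx => by
    have := hX hx
    simp only [Finset.coe_map, Set.mem_image] at this
    obtain ⟨i, -, rfl⟩ := this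
    rfl
  have hadj : ∀ e : M.edgeSet, (blowup H t).Adj (e : Sym2 (V × Fin t)).out.1
      (e : Sym2 (V × Fin t)).out.2 := fun e => by
    have h1 := hfst _ (hadjM e).fst_mem
    have h2 := hfst _ (hadjM e).snd_mem
    exact Or.inr ⟨h1.trans h2.symm, fun h =>
      (hadjM e).ne (Prod.ext (h1.trans h2.symm) h)⟩
  refine ⟨⟨_, _, hout, fun e => SimpleGraph.Path.singleton (hadj e)⟩, fun w => ?_⟩
  have key : ∀ e : M.edgeSet, w ∈ (e : Sym2 (V × Fin t)) → ∃ u, (e : Sym2 (V × Fin t)) = s(w, u) ∧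
      M.Adj w u := fun e he => by
    obtain ⟨u, hu⟩ := he
    exact ⟨u, hu, by rw [← SimpleGraph.Subgraph.mem_edgeSet, ← hu]; exact e.2⟩
  have hsupp : ∀ e : M.edgeSet, w ∈ (SimpleGraph.Path.singleton (hadj e)).1.support → w ∈ (e : Sym2 (V × Fin t)) := fun e he => by
    rw [← hout e]
    simpa [SimpleGraph.Path.singleton] using he
  rw [Nat.cast_one, Set.encard_le_one_iff]
  intro e f he hf
  obtain ⟨a, ha, haw⟩ := key e (hsupp e he)
  obtain ⟨b, hb, hbw⟩ := key f (hsupp f hf)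
  have hab : a = b := (hM haw.fst_mem).unique haw hbw
  exact Subtype.ext (by rw [ha, hb, hab])

/-! This is an argument in the style of Mader. Put k = d(H)/2, so |E| = k|V|. Delete vertices and
contract edges as long as |E| ≥ k|V| survives; linked sets in the blowup of the smaller graph lift
back to the larger one (`WalkLinked.lift`). When no such move is left, some neighbourhood `N`
satisfies |N| ≤ 2κ, with closed degrees inside `N` above κ, for some κ ≥ k.

Among any three closed neighbourhoods in `N`, two share at least κ/3 vertices, since 3κ - 2κ = κ.
Hence either some vertex has small overlap with many others, and these overlap pairwise, or every
vertex overlaps with nearly all of `N`. Clones are then joined greedily through one or three inner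
vertices (`exists_walkLinked_of_dense`). -/

/-! ### Linkage by walks -/

/-- Any finite family of disjoint pairs of vertices of `X` can be joined by walks of `G` that are
pairwise vertex-disjoint. -/
def WalkLinked {V : Type*} (G : SimpleGraph V) (X : Set V) : Prop :=
  ∀ (n : ℕ) (a b : Fin n → V), (∀ i, a i ∈ X) → (∀ i, b i ∈ X) →
    Function.Injective a → Function.Injective b → (∀ i j, a i ≠ b j) →
    ∃ p : ∀ i, G.Walk (a i) (b i), ∀ i j, i ≠ j → ∀ z ∈ (p i).support, z ∉ (p j).support

/-- Walks suffice because `toPath` only shrinks supports, so disjointness survives. -/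
theorem WalkLinked.isMatchingLinked {V : Type*} [Finite V] {G : SimpleGraph V} {X : Set V}
    (h : WalkLinked G X) : IsMatchingLinked G X := by
  classical
  intro M hM hX
  have hout : ∀ e : M.edgeSet, s((e : Sym2 V).out.1, (e : Sym2 V).out.2) = (e : Sym2 V) :=
    fun e => Quot.out_eq _
  have hadj : ∀ e : M.edgeSet, M.Adj (e : Sym2 V).out.1 (e : Sym2 V).out.2 := fun e => by
    rw [← SimpleGraph.Subgraph.mem_edgeSet, hout]; exact e.2
  have huniq : ∀ {x y z : V}, M.Adj x y → M.Adj x z → y = z := fun hy hz =>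
    (hM hy.fst_mem).unique hy hz
  obtain ⟨n, ⟨φ⟩⟩ := Finite.exists_equiv_fin M.edgeSet
  have hext : ∀ e f : M.edgeSet, s((e : Sym2 V).out.1, (e : Sym2 V).out.2) =
      s((f : Sym2 V).out.1, (f : Sym2 V).out.2) → e = f := fun e f hef =>
    Subtype.ext (by rw [← hout e, ← hout f, hef])
  obtain ⟨p, hp⟩ := h n (fun i => ((φ.symm i : M.edgeSet) : Sym2 V).out.1)
    (fun i => ((φ.symm i : M.edgeSet) : Sym2 V).out.2)
    (fun i => hX (hadj _).fst_mem) (fun i => hX (hadj _).snd_mem)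
    (fun i j hij => φ.symm.injective (hext _ _ (by
      have h1 := hadj (φ.symm i)
      have h2 := hadj (φ.symm j)
      simp only at hij
      rw [hij] at h1 ⊢
      rw [huniq h1 h2])))
    (fun i j hij => φ.symm.injective (hext _ _ (by
      have h1 := (hadj (φ.symm i)).symm
      have h2 := (hadj (φ.symm j)).symm
      simp only at hij
      rw [hij] at h1 ⊢
      rw [huniq h1 h2])))
    (fun i j hij => by
      have h1 := hadj (φ.symm i)
      have h2 := (hadj (φ.symm j)).symm
      rw [hij] at h1
      have h3 := huniq h1 h2
      have h4 : φ.symm i = φ.symm j := hext _ _ (by rw [hij, h3, Sym2.eq_swap])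
      rw [h4] at h3
      exact (hadj (φ.symm j)).ne h3.symm)
  have q : ∀ e : M.edgeSet, ∃ q : G.Path (e : Sym2 V).out.1 (e : Sym2 V).out.2,
      ∀ z ∈ q.1.support, z ∈ (p (φ e)).support := fun e => by
    have : φ.symm (φ e) = e := φ.symm_apply_apply e
    generalize φ e = i at this
    subst this
    exact ⟨(p i).toPath, fun z hz => (p i).support_toPath_subset_support hz⟩
  choose q hq using q
  refine ⟨⟨_, _, hout, q⟩, fun w => ?_⟩
  rw [Nat.cast_one, Set.encard_le_one_iff]
  intro e f he hf
  by_contra hef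
  exact hp (φ e) (φ f) (fun h => hef (φ.injective h)) w (hq e w he) (hq f w hf)

/-! ### Lifting linkages along minors -/

section Lift

variable {A B : Type*} {G : SimpleGraph A} {K : SimpleGraph B} {r : B → A → Prop}

/-- Lifting a walk along a minor model whose branch sets are cliques. -/
theorem exists_walk_lift (hfib : ∀ b a a', r b a → r b a' → a = a' ∨ G.Adj a a')
    (hadj : ∀ b b', K.Adj b b' → ∃ a a', r b a ∧ r b' a' ∧ G.Adj a a')
    {b b' : B} (p : K.Walk b b') : ∀ a a', r b a → r b' a' →
      ∃ q : G.Walk a a', ∀ z ∈ q.support, ∃ c ∈ p.support, r c z := by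
  have hone : ∀ b a a', r b a → r b a' → ∃ q : G.Walk a a', ∀ z ∈ q.support, r b z := by
    intro b a a' h h'
    obtain rfl | hne := hfib b a a' h h'
    · exact ⟨.nil, by simpa using h⟩
    · refine ⟨.cons hne .nil, ?_⟩
      simp [h, h']
  induction p with
  | nil =>
    intro a a' h h'
    obtain ⟨q, hq⟩ := hone _ a a' h h'
    exact ⟨q, fun z hz => ⟨_, by simp, hq z hz⟩⟩
  | cons e p ih =>
    intro a a' h h'
    obtain ⟨x, y, hx, hy, hxy⟩ := hadj _ _ e
    obtain ⟨q, hq⟩ := hone _ a x h hx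
    obtain ⟨q', hq'⟩ := ih y a' hy h'
    refine ⟨q.append (.cons hxy q'), fun z hz => ?_⟩
    rw [SimpleGraph.Walk.mem_support_append_iff, SimpleGraph.Walk.support_cons,
      List.mem_cons] at hz
    rcases hz with hz | rfl | hz
    · exact ⟨_, by simp, hq z hz⟩
    · exact ⟨_, by simp, hx⟩
    · obtain ⟨c, hc, hcz⟩ := hq' z hz
      exact ⟨c, by simp [hc], hcz⟩

/-- Here `r b a` means that `a` lies in the branch set of `b`. Branch sets are disjoint by `hfun`,
so lifts of disjoint walks are disjoint. -/
theorem WalkLinked.lift (hfun : ∀ b b' a, r b a → r b' a → b = b')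
    (hfib : ∀ b a a', r b a → r b a' → a = a' ∨ G.Adj a a')
    (hadj : ∀ b b', K.Adj b b' → ∃ a a', r b a ∧ r b' a' ∧ G.Adj a a')
    {f : B → A} (hf : ∀ b, r b (f b)) {X : Set B} (hX : WalkLinked K X) :
    WalkLinked G (f '' X) := by
  intro n a b ha hb hai hbi hab
  choose a' ha' haa' using ha
  choose b' hb' hbb' using hb
  obtain ⟨p, hp⟩ := hX n a' b' ha' hb'
    (fun i j h => hai (by rw [← haa' i, ← haa' j, h]))
    (fun i j h => hbi (by rw [← hbb' i, ← hbb' j, h]))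
    (fun i j h => hab i j (by rw [← haa' i, ← hbb' j, h]))
  have key := fun i => exists_walk_lift hfib hadj (p i) (a i) (b i)
    (by rw [← haa' i]; exact hf _) (by rw [← hbb' i]; exact hf _)
  choose q hq using key
  refine ⟨q, fun i j hij z hz hz' => ?_⟩
  obtain ⟨c, hc, hcz⟩ := hq i z hz
  obtain ⟨c', hc', hcz'⟩ := hq j z hz'
  obtain rfl := hfun _ _ _ hcz hcz'
  exact hp i j hij c hc hc'

end Lift

/-! ### Greedy routing in dense neighbourhoods -/

/-- Greedy routing: if any two vertices of `X` can be joined by a walk with few interior vertices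
avoiding any prescribed small set, then `X` is linked. -/
theorem walkLinked_of_greedy {V : Type*} [DecidableEq V] {G : SimpleGraph V} {X : Finset V} {s : ℕ}
    (h : ∀ U : Finset V, X ⊆ U → 2 * U.card ≤ (2 + s) * X.card → ∀ x ∈ X, ∀ y ∈ X, x ≠ y →
      ∃ (F : Finset V) (p : G.Walk x y), F.card ≤ s ∧ Disjoint F U ∧
        ∀ z ∈ p.support, z = x ∨ z = y ∨ z ∈ F) :
    WalkLinked G (X : Set V) := by
  intro n a b ha hb hai hbi hab
  have hn : 2 * n ≤ X.card := by
    have : Function.Injective (Sum.elim a b) := hai.sumElim hbi hab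
    have h2 := Finset.card_le_card_of_injOn (s := (Finset.univ : Finset (Fin n ⊕ Fin n)))
      (t := X) (Sum.elim a b) (by rintro (i | i) -; exacts [ha i, hb i]) this.injOn
    simp at h2
    omega
  have key : ∀ T : Finset (Fin n), ∃ F : Fin n → Finset V, (∀ i, (F i).card ≤ s) ∧
      (∀ i, Disjoint (F i) X) ∧ (∀ i ∈ T, ∀ j ∈ T, i ≠ j → Disjoint (F i) (F j)) ∧
      ∀ i ∈ T, ∃ p : G.Walk (a i) (b i), ∀ z ∈ p.support, z = a i ∨ z = b i ∨ z ∈ F i := by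
    intro T
    induction T using Finset.induction_on with
    | empty => exact ⟨fun _ => ∅, by simp⟩
    | insert i T hi ih =>
      obtain ⟨F, h1, h2, h3, h4⟩ := ih
      have hcard : (T.biUnion F).card ≤ T.card * s := Finset.card_biUnion_le_card_mul _ _ _
        fun i _ => h1 i
      have hTn : T.card ≤ n := by simpa using T.card_le_univ
      -- The blocked set is `X` plus at most `s` inner vertices for each of at most |X|/2 pairs.
      obtain ⟨F', p, hF', hd, hp⟩ := h (X ∪ T.biUnion F) Finset.subset_union_left (by
        have := Finset.card_union_le X (T.biUnion F)
        have := Nat.mul_le_mul_right s hTn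
        have := Nat.mul_le_mul_right s hn
        nlinarith) (a i) (ha i) (b i) (hb i) (hab i i)
      rw [Finset.disjoint_union_right, Finset.disjoint_biUnion_right] at hd
      have hne : ∀ j ∈ T, j ≠ i := fun j hj hji => hi (hji ▸ hj)
      refine ⟨Function.update F i F', fun j => ?_, fun j => ?_, ?_, ?_⟩
      · by_cases hj : j = i
        · subst hj; simpa using hF'
        · simpa [hj] using h1 j
      · by_cases hj : j = i
        · subst hj; simpa using hd.1
        · simpa [hj] using h2 j
      · intro j hj l hl hjl
        rw [Finset.mem_insert] at hj hl
        rcases hj with rfl | hj <;> rcases hl with rfl | hl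
        · exact absurd rfl hjl
        · simpa [hne l hl] using hd.2 l hl
        · simpa [hne j hj] using (hd.2 j hj).symm
        · simpa [hne j hj, hne l hl] using h3 j hj l hl hjl
      · intro j hj
        rw [Finset.mem_insert] at hj
        rcases hj with rfl | hj
        · exact ⟨p, by simpa using hp⟩
        · simpa [hne j hj] using h4 j hj
  obtain ⟨F, -, h2, h3, h4⟩ := key Finset.univ
  choose p hp using fun i => h4 i (Finset.mem_univ i)
  refine ⟨p, fun i j hij z hz hz' => ?_⟩
  have hF : ∀ i, z ∈ F i → z ∉ X := fun i hi => Finset.disjoint_left.1 (h2 i) hi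
  rcases hp i z hz with e | e | e <;> rcases hp j z hz' with e' | e' | e'
  · exact hij (hai (e ▸ e'))
  · exact hab i j (e ▸ e')
  · exact hF j e' (e ▸ ha i)
  · exact hab j i (e' ▸ e)
  · exact hij (hbi (e ▸ e'))
  · exact hF j e' (e ▸ hb i)
  · exact hF i e (e' ▸ ha j)
  · exact hF i e (e' ▸ hb j)
  · exact Finset.disjoint_left.1 (h3 i (Finset.mem_univ i) j (Finset.mem_univ j) hij) e e'

theorem exists_clone_notMem {V : Type*} [DecidableEq V] {t : ℕ} (U : Finset (V × Fin t))
    (C : Finset V) (h : U.card < C.card * t) : ∃ x : V × Fin t, x.1 ∈ C ∧ x ∉ U := by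
  by_contra! hc
  have : C ×ˢ (Finset.univ : Finset (Fin t)) ⊆ U := fun x hx =>
    hc x (Finset.mem_product.1 hx).1
  have := Finset.card_le_card this
  simp at this
  omega

theorem exists_clones_card {V : Type*} {t m : ℕ} (C : Finset V) (h : m ≤ C.card * t) :
    ∃ X : Finset (V × Fin t), X.card = m ∧ ∀ x ∈ X, x.1 ∈ C := by
  obtain ⟨X, hX, hm⟩ := Finset.exists_subset_card_eq
    (s := C ×ˢ (Finset.univ : Finset (Fin t))) (n := m) (by simpa using h)
  exact ⟨X, hm, fun x hx => (Finset.mem_product.1 (hX hx)).1⟩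

theorem blowup_adj_of_closedNbhd {V : Type*} {H : SimpleGraph V} {t : ℕ} {x y : V × Fin t}
    (hne : x ≠ y) (h : y.1 = x.1 ∨ H.Adj x.1 y.1) : (blowup H t).Adj x y :=
  h.elim (fun h => Or.inr ⟨h.symm, fun h' => hne (Prod.ext h.symm h')⟩) Or.inl

theorem card_add_card_add_card_le {V : Type*} [DecidableEq V] {A B C N : Finset V} (hA : A ⊆ N)
    (hB : B ⊆ N) (hC : C ⊆ N) :
    A.card + B.card + C.card ≤ N.card + (A ∩ B).card + (A ∩ C).card + (B ∩ C).card := by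
  have h1 := Finset.card_union_add_card_inter A B
  have h2 := Finset.card_union_add_card_inter (A ∪ B) C
  have h3 := Finset.card_le_card (Finset.union_subset (Finset.union_subset hA hB) hC)
  rw [Finset.union_inter_distrib_right] at h2
  have h4 := Finset.card_union_le (A ∩ C) (B ∩ C)
  omega

/-- In a set `N` of at most `2κ` vertices that contains more than `κ` vertices of the closed
neighbourhood of each of its elements, the clones of `N` contain a large linked set. -/
theorem exists_walkLinked_of_dense {V : Type*} (H : SimpleGraph V) [DecidableEq V]
    [DecidableRel H.Adj] (N : Finset V) {κ : ℝ} (hN : (N.card : ℝ) ≤ 2 * κ) (hN' : κ < N.card)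
    (hdeg : ∀ w ∈ N, κ < (N.filter fun z => z = w ∨ H.Adj w z).card)
    {t m : ℕ} (hm : (m : ℝ) ≤ κ * t / 24) :
    ∃ X : Finset (V × Fin t), X.card = m ∧ WalkLinked (blowup H t) (X : Set (V × Fin t)) := by
  set C : V → Finset V := fun w => N.filter fun z => z = w ∨ H.Adj w z with hCdef
  have hC : ∀ w, C w ⊆ N := fun w => Finset.filter_subset _ _
  have hCadj : ∀ {x y : V × Fin t}, x ≠ y → y.1 ∈ C x.1 → (blowup H t).Adj x y := fun hne hy =>
    blowup_adj_of_closedNbhd hne (Finset.mem_filter.1 hy).2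
  have htriple : ∀ u ∈ N, ∀ v ∈ N, ∀ w ∈ N, ((C u ∩ C v).card : ℝ) < κ / 3 →
      ((C u ∩ C w).card : ℝ) < κ / 3 → κ / 3 ≤ ((C v ∩ C w).card : ℝ) := by
    intro u hu v hv w hw h1 h2
    have h3 : ((C u).card : ℝ) + (C v).card + (C w).card ≤
        N.card + (C u ∩ C v).card + (C u ∩ C w).card + (C v ∩ C w).card := by
      exact_mod_cast card_add_card_add_card_le (hC u) (hC v) (hC w)
    have := hdeg u hu
    have := hdeg v hv
    have := hdeg w hw
    linarith
  -- `B u` collects the vertices with small overlap with `u`; by `htriple` they overlap pairwise.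
  set B : V → Finset V := fun u => N.filter fun w => ((C u ∩ C w).card : ℝ) < κ / 3 with hBdef
  have hκ : 0 < κ := by
    by_contra h
    have : (0 : ℝ) ≤ N.card := Nat.cast_nonneg _
    linarith
  have ht0 : (0 : ℝ) ≤ t := Nat.cast_nonneg _
  have htwo : ∀ X : Finset (V × Fin t), ∀ x ∈ X, ∀ y ∈ X, x ≠ y → (2 : ℝ) ≤ X.card := by
    intro X x hx y hy hxy
    exact_mod_cast Finset.one_lt_card.2 ⟨x, hx, y, hy, hxy⟩
  by_cases hB : ∃ u ∈ N, κ / 24 ≤ ((B u).card : ℝ)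
  · obtain ⟨u, hu, hBu⟩ := hB
    obtain ⟨X, hXm, hX⟩ := exists_clones_card (m := m) (t := t) (B u) (by
      have : (m : ℝ) ≤ (B u).card * t := by nlinarith
      exact_mod_cast this)
    refine ⟨X, hXm, walkLinked_of_greedy (s := 1) fun U hU hUc x hx y hy hxy => ?_⟩
    have hm2 := htwo X x hx y hy hxy
    obtain ⟨hxN, hxu⟩ := Finset.mem_filter.1 (hX x hx)
    obtain ⟨hyN, hyu⟩ := Finset.mem_filter.1 (hX y hy)
    have hco := htriple u hu x.1 hxN y.1 hyN hxu hyu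
    have hUc' : (2 : ℝ) * U.card ≤ (2 + 1) * m := by rw [← hXm]; exact_mod_cast hUc
    -- At most 3m/2 ≤ κt/16 clones are blocked, fewer than the κt/3 available; m ≥ 2 forces κt > 0.
    obtain ⟨z, hz, hzU⟩ := exists_clone_notMem U (C x.1 ∩ C y.1) (by
      have : (U.card : ℝ) < (C x.1 ∩ C y.1).card * t := by
        rw [hXm] at hm2
        nlinarith
      exact_mod_cast this)
    rw [Finset.mem_inter] at hz
    have h1 := hCadj (x := x) (by rintro rfl; exact hzU (hU hx)) hz.1
    have h2 := hCadj (x := y) (by rintro rfl; exact hzU (hU hy)) hz.2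
    refine ⟨{z}, .cons h1 (.cons h2.symm .nil), by simp, by simpa using hzU, ?_⟩
    simp
  · push Not at hB
    obtain ⟨X, hXm, hX⟩ := exists_clones_card (m := m) (t := t) N (by
      have : (m : ℝ) ≤ N.card * t := by nlinarith
      exact_mod_cast this)
    refine ⟨X, hXm, walkLinked_of_greedy (s := 3) fun U hU hUc x hx y hy hxy => ?_⟩
    have hm2 := htwo X x hx y hy hxy
    rw [hXm] at hm2
    have hUc' : (2 : ℝ) * U.card ≤ (2 + 3) * m := by rw [← hXm]; exact_mod_cast hUc
    have hxN := hX x hx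
    have hyN := hX y hy
    -- Both `B` sets are below κ/24, so more than κ - κ/12 possible hubs remain.
    have hhub : κ / 3 ≤ ((N \ (B x.1 ∪ B y.1)).card : ℝ) := by
      have h1 : (N.card : ℝ) ≤ (N \ (B x.1 ∪ B y.1)).card + ((B x.1).card + (B y.1).card) := by
        have h2 := Finset.le_card_sdiff (B x.1 ∪ B y.1) N
        have h3 := Finset.card_union_le (B x.1) (B y.1)
        have : N.card ≤ (N \ (B x.1 ∪ B y.1)).card + ((B x.1).card + (B y.1).card) := by omega
        exact_mod_cast this
      have := hB _ hxN
      have := hB _ hyN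
      linarith
    -- As m ≥ 2, |U| + 2 ≤ 5m/2 + m ≤ 7κt/48 < κt/3.
    have hfree : ∀ (U' : Finset (V × Fin t)) (D : Finset V), U'.card ≤ U.card + 2 →
        κ / 3 ≤ (D.card : ℝ) → ∃ z : V × Fin t, z.1 ∈ D ∧ z ∉ U' := by
      intro U' D hU' hD
      refine exists_clone_notMem U' D ?_
      have h1 : (U'.card : ℝ) ≤ U.card + 2 := by exact_mod_cast hU'
      have : (U'.card : ℝ) < D.card * t := by nlinarith
      exact_mod_cast this
    obtain ⟨w, hw, hwU⟩ := hfree U _ (by omega) hhub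
    rw [Finset.mem_sdiff, Finset.mem_union, not_or] at hw
    obtain ⟨hwN, hwx, hwy⟩ := hw
    have hxw : κ / 3 ≤ ((C x.1 ∩ C w.1).card : ℝ) := by
      by_contra h
      exact hwx (Finset.mem_filter.2 ⟨hwN, not_le.1 h⟩)
    have hyw : κ / 3 ≤ ((C y.1 ∩ C w.1).card : ℝ) := by
      by_contra h
      exact hwy (Finset.mem_filter.2 ⟨hwN, not_le.1 h⟩)
    obtain ⟨a, ha, haU⟩ := hfree (insert w U) _
      ((Finset.card_insert_le _ _).trans (by omega)) hxw
    obtain ⟨b, hb, hbU⟩ := hfree (insert w U) _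
      ((Finset.card_insert_le _ _).trans (by omega)) hyw
    rw [Finset.mem_inter] at ha hb
    rw [Finset.mem_insert, not_or] at haU hbU
    have h1 := hCadj (x := x) (by rintro rfl; exact haU.2 (hU hx)) ha.1
    have h2 := hCadj (Ne.symm haU.1) ha.2
    have h3 := hCadj (Ne.symm hbU.1) hb.2
    have h4 := hCadj (x := y) (by rintro rfl; exact hbU.2 (hU hy)) hb.1
    -- `a` and `b` may coincide; only a walk is required.
    refine ⟨{a, w, b}, .cons h1 (.cons h2.symm (.cons h3 (.cons h4.symm .nil))),
      Finset.card_le_three, ?_, ?_⟩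
    · rw [Finset.disjoint_left]
      intro z hz
      simp only [Finset.mem_insert, Finset.mem_singleton] at hz
      rcases hz with rfl | rfl | rfl
      exacts [haU.2, hwU, hbU.2]
    · intro z hz
      simp only [SimpleGraph.Walk.support_cons, SimpleGraph.Walk.support_nil, List.mem_cons,
        List.not_mem_nil, or_false] at hz
      simp only [Finset.mem_insert, Finset.mem_singleton]
      tauto

/-! ### Deletion and contraction -/

/-- The contraction of `v` into `u`, as a graph on the same vertex set in which `v` is isolated. -/
def contraction {V : Type*} (H : SimpleGraph V) (u v : V) : SimpleGraph V where
  Adj x y := x ≠ v ∧ y ≠ v ∧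
    (H.Adj x y ∨ (x = u ∧ y ≠ u ∧ H.Adj v y) ∨ (y = u ∧ x ≠ u ∧ H.Adj v x))
  symm := ⟨fun x y h => ⟨h.2.1, h.1, h.2.2.elim (fun h => Or.inl h.symm) (fun h => Or.inr h.symm)⟩⟩
  loopless := ⟨fun x h => by
    rcases h.2.2 with h | ⟨h, h', -⟩ | ⟨h, h', -⟩
    exacts [H.loopless.irrefl x h, h' h, h' h]⟩

theorem exists_walkLinked_of_contraction {V : Type*} {H : SimpleGraph V} {u v : V} (huv : H.Adj u v)
    {t m : ℕ} (h : ∃ X : Finset (({v}ᶜ : Set V) × Fin t), X.card = m ∧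
      WalkLinked (blowup ((contraction H u v).induce {v}ᶜ) t) (X : Set (({v}ᶜ : Set V) × Fin t))) :
    ∃ X : Finset (V × Fin t), X.card = m ∧ WalkLinked (blowup H t) (X : Set (V × Fin t)) := by
  obtain ⟨X, hX, hl⟩ := h
  let f : ({v}ᶜ : Set V) × Fin t ↪ V × Fin t :=
    ⟨fun x => (x.1.1, x.2), fun x y h => Prod.ext (Subtype.ext (Prod.ext_iff.1 h).1)
      (Prod.ext_iff.1 h).2⟩
  refine ⟨X.map f, by simpa using hX, ?_⟩
  rw [Finset.coe_map]
  -- The branch set of (u, i) is the edge {(u, i), (v, i)}; all others are singletons.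
  refine hl.lift (r := fun b a => b.2 = a.2 ∧ (b.1.1 = a.1 ∨ (b.1.1 = u ∧ a.1 = v))) ?_ ?_ ?_
    (f := f) (fun b => ⟨rfl, Or.inl rfl⟩)
  · rintro ⟨⟨b, hb⟩, i⟩ ⟨⟨b', hb'⟩, i'⟩ ⟨a, j⟩ ⟨rfl, h⟩ ⟨rfl, h'⟩
    simp only [Set.mem_compl_iff, Set.mem_singleton_iff] at h h' hb hb'
    simp only [Prod.mk.injEq, Subtype.mk.injEq, and_true]
    grind
  · rintro ⟨⟨b, hb⟩, i⟩ ⟨a, j⟩ ⟨a', j'⟩ ⟨rfl, h⟩ ⟨rfl, h'⟩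
    simp only [Set.mem_compl_iff, Set.mem_singleton_iff] at h h' hb
    rcases h with rfl | ⟨rfl, rfl⟩ <;> rcases h' with h' | ⟨h', h''⟩
    · subst h'; exact Or.inl rfl
    · subst h' h''; exact Or.inr (Or.inl huv)
    · subst h'; exact Or.inr (Or.inl huv.symm)
    · exact Or.inl (by rw [h''])
  · rintro ⟨⟨b, hb⟩, i⟩ ⟨⟨b', hb'⟩, i'⟩ (h | ⟨h, h'⟩)
    · rcases h.2.2 with h | ⟨rfl, -, h⟩ | ⟨rfl, -, h⟩
      · exact ⟨(b, i), (b', i'), ⟨rfl, Or.inl rfl⟩, ⟨rfl, Or.inl rfl⟩, Or.inl h⟩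
      · exact ⟨(v, i), (b', i'), ⟨rfl, Or.inr ⟨rfl, rfl⟩⟩, ⟨rfl, Or.inl rfl⟩, Or.inl h⟩
      · exact ⟨(b, i), (v, i'), ⟨rfl, Or.inl rfl⟩, ⟨rfl, Or.inr ⟨rfl, rfl⟩⟩, Or.inl h.symm⟩
    · exact ⟨(b, i), (b', i'), ⟨rfl, Or.inl rfl⟩, ⟨rfl, Or.inl rfl⟩,
        Or.inr ⟨congrArg Subtype.val h, h'⟩⟩

theorem exists_walkLinked_of_induce {V : Type*} {H : SimpleGraph V} {s : Set V}
    {t m : ℕ} (h : ∃ X : Finset (s × Fin t), X.card = m ∧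
      WalkLinked (blowup (H.induce s) t) (X : Set (s × Fin t))) :
    ∃ X : Finset (V × Fin t), X.card = m ∧ WalkLinked (blowup H t) (X : Set (V × Fin t)) := by
  obtain ⟨X, hX, hl⟩ := h
  let f : s × Fin t ↪ V × Fin t :=
    ⟨fun x => (x.1.1, x.2), fun x y h => Prod.ext (Subtype.ext (Prod.ext_iff.1 h).1)
      (Prod.ext_iff.1 h).2⟩
  refine ⟨X.map f, by simpa using hX, ?_⟩
  rw [Finset.coe_map]
  refine hl.lift (r := fun b a => f b = a) (fun b b' a h h' => f.injective (h.trans h'.symm))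
    (fun b a a' h h' => Or.inl (h.symm.trans h')) (fun b b' h => ⟨f b, f b', rfl, rfl, ?_⟩)
    (f := f) (fun b => rfl)
  exact h.imp id fun h => ⟨congrArg Subtype.val h.1, h.2⟩

open Classical in
/-- A contraction loses at most one edge, and one more for each common neighbour. -/
theorem card_edgeFinset_le_contraction {V : Type*} [Fintype V] {H : SimpleGraph V} {u v : V}
    (huv : H.Adj u v) :
    H.edgeFinset.card ≤ ((contraction H u v).induce {v}ᶜ).edgeFinset.card + 1 +
      (H.neighborFinset u ∩ H.neighborFinset v).card := by
  have hind : ((contraction H u v).induce {v}ᶜ).edgeFinset.card =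
      (contraction H u v).edgeFinset.card := by
    refine SimpleGraph.card_edgeFinset_induce_of_support_subset ?_
    rintro x ⟨y, hxy⟩
    exact hxy.1
  -- These neighbours of `v` yield the new edges at `u`.
  set T := H.neighborFinset v \ insert u (H.neighborFinset u) with hT
  have hdisj : Disjoint (H.deleteIncidenceSet v).edgeFinset (T.image fun y => s(u, y)) := by
    rw [Finset.disjoint_left]
    intro e he he'
    obtain ⟨y, hy, rfl⟩ := Finset.mem_image.1 he'
    rw [SimpleGraph.mem_edgeFinset, SimpleGraph.mem_edgeSet,
      SimpleGraph.deleteIncidenceSet_adj] at he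
    simp only [hT, Finset.mem_sdiff, Finset.mem_insert, SimpleGraph.mem_neighborFinset] at hy
    tauto
  have hsub : (H.deleteIncidenceSet v).edgeFinset ∪ (T.image fun y => s(u, y)) ⊆
      (contraction H u v).edgeFinset := by
    intro e he
    rcases Finset.mem_union.1 he with he | he
    · induction e with | h x y
      rw [SimpleGraph.mem_edgeFinset, SimpleGraph.mem_edgeSet,
        SimpleGraph.deleteIncidenceSet_adj] at he
      rw [SimpleGraph.mem_edgeFinset, SimpleGraph.mem_edgeSet]
      exact ⟨he.2.1, he.2.2, Or.inl he.1⟩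
    · obtain ⟨y, hy, rfl⟩ := Finset.mem_image.1 he
      simp only [hT, Finset.mem_sdiff, Finset.mem_insert, SimpleGraph.mem_neighborFinset] at hy
      rw [SimpleGraph.mem_edgeFinset, SimpleGraph.mem_edgeSet]
      exact ⟨huv.ne, hy.1.ne', Or.inr (Or.inl ⟨rfl, fun h => hy.2 (Or.inl h), hy.1⟩)⟩
  have h1 := Finset.card_le_card hsub
  rw [Finset.card_union_of_disjoint hdisj, Finset.card_image_of_injOn
    (fun a _ b _ h => Sym2.congr_right.1 h), SimpleGraph.card_edgeFinset_deleteIncidenceSet] at h1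
  have h2 : H.degree v ≤ T.card + 1 + (H.neighborFinset u ∩ H.neighborFinset v).card := by
    rw [← SimpleGraph.card_neighborFinset_eq_degree]
    have h3 : H.neighborFinset v ⊆
        T ∪ insert u (H.neighborFinset u ∩ H.neighborFinset v) := by
      intro y hy
      simp only [hT, Finset.mem_union, Finset.mem_sdiff, Finset.mem_insert, Finset.mem_inter]
      tauto
    have h4 := Finset.card_le_card h3
    have h5 := Finset.card_union_le T (insert u (H.neighborFinset u ∩ H.neighborFinset v))
    have h6 := Finset.card_insert_le u (H.neighborFinset u ∩ H.neighborFinset v)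
    omega
  omega

/-! ### Induction on the number of vertices -/

open Classical in
/-- A graph with at least `k` times as many edges as vertices has large linked sets in its
blowups. -/
theorem exists_walkLinked_of_card_edges {k : ℝ} (hk : 0 < k) {t m : ℕ}
    (hm : (m : ℝ) ≤ k * t / 24) (n : ℕ) : ∀ {V : Type*} [Fintype V] [Nonempty V]
      (H : SimpleGraph V), Fintype.card V = n → k * n ≤ H.edgeFinset.card →
    ∃ X : Finset (V × Fin t), X.card = m ∧ WalkLinked (blowup H t) (X : Set (V × Fin t)) := by
  induction n with
  | zero => intro V _ _ H h; simp at h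
  | succ n ih =>
    intro V _ _ H hV he
    have hcompl : ∀ v : V, Fintype.card ({v}ᶜ : Set V) = n := fun v => by
      rw [Fintype.card_compl_set]; simp [hV]
    have hnonempty : ∀ v : V, Nonempty ({v}ᶜ : Set V) := fun v => by
      rw [← Fintype.card_pos_iff, hcompl v]
      by_contra hn
      have hn : n = 0 := by omega
      subst hn
      have hE : H.edgeFinset = ∅ := by
        have := Fintype.card_le_one_iff_subsingleton.1 hV.le
        rw [SimpleGraph.edgeFinset_eq_empty]
        ext x y
        simp [Subsingleton.elim x y]
      rw [hE] at he
      norm_num at he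
      linarith
    -- κ is the number of edges that one step may lose while keeping k edges per vertex.
    set κ : ℝ := k + (H.edgeFinset.card - k * (n + 1 : ℕ)) with hκ
    have hkκ : k ≤ κ := by linarith
    have he' : (H.edgeFinset.card : ℝ) - κ = k * n := by
      rw [hκ]; push_cast; ring
    by_cases hdel : ∃ v, (H.degree v : ℝ) ≤ κ
    · obtain ⟨v, hv⟩ := hdel
      have := hnonempty v
      refine exists_walkLinked_of_induce (ih (H.induce {v}ᶜ) (hcompl v) ?_)
      have h1 : (H.edgeFinset.card : ℝ) ≤ (H.induce {v}ᶜ).edgeFinset.card + H.degree v := by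
        have h2 := H.card_edgeFinset_induce_compl_singleton v
        rw [H.card_edgeFinset_deleteIncidenceSet v] at h2
        have h3 : H.edgeFinset.card ≤ (H.induce {v}ᶜ).edgeFinset.card + H.degree v := by
          omega
        exact_mod_cast h3
      have h4 : k * n ≤ (H.induce {v}ᶜ).edgeFinset.card := by linarith
      convert h4
    by_cases hcon : ∃ u v, H.Adj u v ∧
        ((H.neighborFinset u ∩ H.neighborFinset v).card + 1 : ℝ) ≤ κ
    · obtain ⟨u, v, huv, hc⟩ := hcon
      have := hnonempty v
      refine exists_walkLinked_of_contraction huv (ih _ (hcompl v) ?_)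
      have h1 : (H.edgeFinset.card : ℝ) ≤
          ((contraction H u v).induce {v}ᶜ).edgeFinset.card + 1 +
          (H.neighborFinset u ∩ H.neighborFinset v).card := by
        exact_mod_cast card_edgeFinset_le_contraction huv
      have h4 : k * n ≤ ((contraction H u v).induce {v}ᶜ).edgeFinset.card := by linarith
      convert h4
    push Not at hdel hcon
    -- The average degree is at most 2κ, since |E| = κ + kn ≤ κ(n + 1).
    obtain ⟨v, hv⟩ : ∃ v, (H.degree v : ℝ) ≤ 2 * κ := by
      by_contra! h
      have h1 : ∑ _v : V, 2 * κ < ∑ v : V, (H.degree v : ℝ) :=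
        Finset.sum_lt_sum_of_nonempty Finset.univ_nonempty fun v _ => h v
      have h2 : ∑ v : V, (H.degree v : ℝ) = 2 * H.edgeFinset.card := by
        exact_mod_cast H.sum_degrees_eq_twice_card_edges
      rw [h2, Finset.sum_const, Finset.card_univ, hV, nsmul_eq_mul] at h1
      have h3 : (0 : ℝ) ≤ n := Nat.cast_nonneg n
      push_cast at h1
      nlinarith
    refine exists_walkLinked_of_dense H (H.neighborFinset v) (κ := κ) (by simpa using hv)
      (by simpa using hdel v) (fun w hw => ?_) (hm.trans (by gcongr))
    have hw' : H.Adj v w := by simpa using hw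
    refine (hcon v w hw').trans_le ?_
    -- Counting `w` itself supplies the + 1 in `hcon`.
    have h1 : insert w (H.neighborFinset v ∩ H.neighborFinset w) ⊆
        (H.neighborFinset v).filter fun z => z = w ∨ H.Adj w z := by
      intro z hz
      simp only [Finset.mem_insert, Finset.mem_inter, SimpleGraph.mem_neighborFinset,
        Finset.mem_filter] at hz ⊢
      rcases hz with rfl | hz
      exacts [⟨hw', Or.inl rfl⟩, ⟨hz.1, Or.inr hz.2⟩]
    have h2 := Finset.card_le_card h1
    rw [Finset.card_insert_of_notMem (by simp)] at h2
    exact_mod_cast h2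

theorem lemma5p3 {V : Type*} [Finite V] (H : SimpleGraph V) :
    linkageCapacity H ≥ averageDegree H / 48 := by
  classical
  have hnonneg : 0 ≤ linkageCapacity H := Real.sSup_nonneg fun c hc => hc.1.le
  by_cases hd : averageDegree H ≤ 0
  · exact le_trans (by linarith) hnonneg
  push Not at hd
  have := Fintype.ofFinite V
  have hne : Nonempty V := by
    by_contra h
    rw [not_nonempty_iff] at h
    simp [averageDegree] at hd
  refine le_csSup (bddAbove_linkageRates H) ⟨by positivity, Filter.Eventually.of_forall fun t => ?_⟩
  obtain ⟨X, hX, hl⟩ := exists_walkLinked_of_card_edges (k := averageDegree H / 2)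
    (by positivity) (t := t) (m := ⌊averageDegree H / 48 * t⌋₊)
    ((Nat.floor_le (by positivity)).trans (by linarith)) _ H rfl (by
      have h0 : (Fintype.card V : ℝ) ≠ 0 := by simp
      rw [averageDegree, Nat.card_eq_fintype_card, Set.ncard_eq_toFinset_card']
      apply le_of_eq
      field_simp
      simp [SimpleGraph.edgeFinset])
  exact ⟨X, hX, hl.isMatchingLinked⟩
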